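/- Let $n$ and $k$ be integers with $n\ge 2k$ and $k\ge 3$, and let $c,r$ be the unique integers with $n=ck+r$ and $0\le r\le k-1$. Suppose that $n$ is even and $ck$ is odd (so that $r$ is odd, in particular $r\geq 1$). Let $u\in\{\frac{c+1}{2},\ldots,c-1\}$ be such that $u=\frac{c+1}{2}$ if $r=1$, and put \[a(u)=2\sum_{i=u+1}^{c}\binom{n/2}{i}\binom{n/2}{c-i},\qquad b(u)=\sum_{i=c+1-u}^{u}\binom{n/2}{i}\binom{n/2}{c+1-i}.\] Then there exists an almost uniform $(n,k)$-Sperner partition system with exactly \[p=\min\left(\left\lfloor\frac{a(u)}{k-r}\right\rfloor,\left\lfloor\frac{b(u)}{r}\right\rfloor\right)\] partitions. Here an $(n,k)$-Sperner partition system is a set of partitions of some $n$-set, each into $k$ nonempty classes, such that no class of any partition is a subset of a class of any other partition in the system; it is almost uniform if every class of every partition has cardinality in $\{\lfloor n/k\rfloor,\lceil n/k\rceil\}$. -/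

import Mathlib

/-- A finite set `P` of partitions of the finite set `X` is an `(n, k)`-Sperner partition system
if `X` has `n` elements, every partition in `P` has exactly `k` classes (the classes of a
`Finpartition` are nonempty), and no class of a partition in `P` is a subset of a class of a
different partition in `P`. -/
structure IsSpernerPartitionSystem {α : Type*} [DecidableEq α] (n k : ℕ) {X : Finset α}
    (P : Finset (Finpartition X)) : Prop where
  card_ground : X.card = n
  card_parts : ∀ π ∈ P, π.parts.card = k
  not_subset : ∀ π ∈ P, ∀ ρ ∈ P, π ≠ ρ → ∀ A ∈ π.parts, ∀ B ∈ ρ.parts, ¬ A ⊆ B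

/-- An `(n, k)`-Sperner partition system is almost uniform if every class of every partition
in it has cardinality `⌊n / k⌋` or `⌈n / k⌉`. -/
structure IsAlmostUniformSPS {α : Type*} [DecidableEq α] (n k : ℕ) {X : Finset α}
    (P : Finset (Finpartition X)) : Prop extends IsSpernerPartitionSystem n k P where
  card_class : ∀ π ∈ P, ∀ A ∈ π.parts, A.card = n / k ∨ A.card = n ⌈/⌉ k

/-- `a(u) = 2 ∑_{i = u + 1}^{c} (n/2 choose i) (n/2 choose c - i)`. -/
def altA (n c u : ℕ) : ℕ :=
  2 * ∑ i ∈ Finset.Icc (u + 1) c, (n / 2).choose i * (n / 2).choose (c - i)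

/-- `b(u) = ∑_{i = c + 1 - u}^{u} (n/2 choose i) (n/2 choose c + 1 - i)`. -/
def altB (n c u : ℕ) : ℕ :=
  ∑ i ∈ Finset.Icc (c + 1 - u) u, (n / 2).choose i * (n / 2).choose (c + 1 - i)

/-! Split the ground set into halves of size m = n/2 and put h = (c+1)/2, w = u - h. Let every class
of size c have more than u points in one half, and every class of size c+1 at most u points in each
half. Then no c-class lies in a (c+1)-class, so it suffices that all classes are distinct; a(u) and
b(u) count the admissible sets of the two sizes.

By a Baranyai-type theorem (`exists_bipartite_partition`) only the pairs of intersection sizes with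
the halves need choosing: in each partition they add up to m in both halves, and (x, y) occurs at
most (m choose x)(m choose y) times overall. The k - r classes of size c, an even number, come in
mirror pairs (t, c-t), (c-t, t), which are balanced. The r classes of size c+1 have types (h+v, h-v)
with |v| ≤ w, and their deviations v must sum to zero in each partition.

The available deviations form a symmetric multiset with multiplicities strictly decreasing in |v|, a
stair. If r ≥ 3 is odd, `IsStair.exists_zero_sum` finds the p zero-sum groups: removing opposite
pairs from the top keeps a stair and reduces r to 3, and a stair splits into zero-sum triples up to
at most two elements (`IsStair.exists_zeroTriples`). For r = 1 only v = 0 can be used, whence u = h.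

The Baranyai-type theorem assigns the points one at a time; the classes receiving a point are found
by rounding a fractional assignment with Hall's theorem. -/

/-! ### Zero-sum triples in sums of symmetric intervals -/

/-- The multisets of integers that split into zero-sum triples. -/
def zeroTriples : AddSubmonoid (Multiset ℤ) :=
  AddSubmonoid.closure {t | Multiset.card t = 3 ∧ t.sum = 0}

/-- The multiset `{±(a + 1), …, ±(a + n)}`. -/
def symRange (a n : ℕ) : Multiset ℤ :=
  ∑ i ∈ Finset.range n, ({(a + i + 1 : ℤ), -(a + i + 1 : ℤ)} : Multiset ℤ)

/-- The multiset `{-m, …, m}`. -/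
def symLayer (m : ℕ) : Multiset ℤ := {0} + symRange 0 m

theorem triple_mem_zeroTriples {x y z : ℤ} (h : x + y + z = 0) :
    ({x, y, z} : Multiset ℤ) ∈ zeroTriples :=
  AddSubmonoid.subset_closure ⟨by simp, by simpa [add_assoc] using h⟩

theorem symRange_add (a n k : ℕ) : symRange a (n + k) = symRange a n + symRange (a + n) k := by
  simp only [symRange, Finset.sum_range_add]
  congr 1
  refine Finset.sum_congr rfl fun i _ => ?_
  push_cast
  simp only [add_assoc]

theorem sum_range_two_mul_parity {M : Type*} [AddCommMonoid M] (F : ℕ → M) (t : ℕ) :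
    ∑ i ∈ Finset.range (2 * t), F i =
      ∑ i ∈ Finset.range t, F (2 * i) + ∑ i ∈ Finset.range t, F (2 * i + 1) := by
  induction t with
  | zero => simp
  | succ t ih =>
    rw [show 2 * (t + 1) = 2 * t + 1 + 1 by ring, Finset.sum_range_succ, Finset.sum_range_succ, ih,
      Finset.sum_range_succ, Finset.sum_range_succ]
    abel

theorem symRange_eq (a n : ℕ) : symRange a n =
    ∑ i ∈ Finset.range n, ({(a + i + 1 : ℤ)} : Multiset ℤ) +
      ∑ i ∈ Finset.range n, ({-(a + i + 1 : ℤ)} : Multiset ℤ) := by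
  rw [← Finset.sum_add_distrib]; rfl

/-- A perfect shuffle: `{±1, …, ±t}` and `{±(a + 1), …, ±(a + 2 t)}` split into zero-sum
triples. -/
theorem symRange_shuffle (a t : ℕ) : symRange 0 t + symRange a (2 * t) ∈ zeroTriples := by
  -- The triples are (i+1, a+i+1, -(a+2i+2)) and (-(t-i), a+t+i+1, -(a+2i+1)): the negative large
  -- entries are divided by parity, the positive ones into a lower and an upper half.
  have key : symRange 0 t + symRange a (2 * t) =
      ∑ i ∈ Finset.range t,
        ({(i + 1 : ℤ), (a + i + 1 : ℤ), -(a + (2 * i + 1 : ℕ) + 1 : ℤ)} : Multiset ℤ) +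
      ∑ i ∈ Finset.range t,
        ({-((t - 1 - i : ℕ) + 1 : ℤ), (a + (t + i : ℕ) + 1 : ℤ), -(a + (2 * i : ℕ) + 1 : ℤ)} :
          Multiset ℤ) := by
    have split (x y z : ℤ) : ({x, y, z} : Multiset ℤ) = {x} + {y} + {z} := by
      simp [← Multiset.singleton_add, add_assoc]
    simp only [split, Finset.sum_add_distrib]
    rw [Finset.sum_range_reflect (fun i => ({-((i : ℕ) + 1 : ℤ)} : Multiset ℤ)),
      symRange_eq, symRange_eq a,
      sum_range_two_mul_parity (fun i => ({-(a + (i : ℕ) + 1 : ℤ)} : Multiset ℤ)), two_mul t,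
      Finset.sum_range_add (fun i => ({(a + (i : ℕ) + 1 : ℤ)} : Multiset ℤ))]
    simp only [Nat.cast_zero, zero_add]
    abel
  rw [key]
  refine add_mem (sum_mem fun i _ => ?_) (sum_mem fun i hi => ?_)
  · refine triple_mem_zeroTriples ?_
    push_cast
    ring
  · refine triple_mem_zeroTriples ?_
    have : i < t := by simpa using hi
    rw [Nat.sub_sub, Nat.cast_sub (by omega)]
    push_cast
    ring

/-- The multisets of integers that split into zero-sum triples and zeros. -/
def zeroTriplesZeros : AddSubmonoid (Multiset ℤ) := zeroTriples ⊔ AddSubmonoid.multiples {0}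

theorem zeroTriples_le : zeroTriples ≤ zeroTriplesZeros := le_sup_left

theorem zero_mem_zeroTriplesZeros : ({0} : Multiset ℤ) ∈ zeroTriplesZeros :=
  (le_sup_right : _ ≤ zeroTriplesZeros) (AddSubmonoid.mem_multiples _)

theorem mem_zeroTriplesZeros {M : Multiset ℤ} (h : M ∈ zeroTriplesZeros) :
    ∃ Z ∈ zeroTriples, ∃ n : ℕ, M = Z + n • {0} := by
  obtain ⟨Z, hZ, _, ⟨n, rfl⟩, rfl⟩ := AddSubmonoid.mem_sup.1 h
  exact ⟨Z, hZ, n, rfl⟩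

theorem symRange_one_add_zero (a : ℕ) : {0} + symRange a 1 ∈ zeroTriples := by
  have : {0} + symRange a 1 = ({0, (a + 1 : ℤ), -(a + 1 : ℤ)} : Multiset ℤ) := by
    simp only [symRange, Finset.sum_range_one, Multiset.singleton_add, Nat.cast_zero, add_zero]
    rfl
  rw [this]
  exact triple_mem_zeroTriples (by ring)

theorem symLayer_three_mul (s : ℕ) : symLayer (3 * s) ∈ zeroTriplesZeros := by
  rw [symLayer, show 3 * s = s + 2 * s by ring, symRange_add]
  exact add_mem zero_mem_zeroTriplesZeros (zeroTriples_le (symRange_shuffle _ _))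

theorem symLayer_three_mul_add_one (s : ℕ) : symLayer (3 * s + 1) ∈ zeroTriplesZeros := by
  rw [symLayer, show 3 * s + 1 = s + 2 * s + 1 by ring, symRange_add, symRange_add, add_left_comm]
  exact zeroTriples_le (add_mem (symRange_shuffle _ _) (symRange_one_add_zero _))

/-- One such layer has 6s+5 ≡ 2 (mod 3) elements and a single zero, so it cannot split alone. Two
copies are cut at different heights, s in one and s+1, s+2 in the other, and exchange their upper
parts to form two shuffles; ±(s+2) takes up one of the zeros. -/
theorem symLayer_add_self (s : ℕ) :
    symLayer (3 * s + 2) + symLayer (3 * s + 2) ∈ zeroTriplesZeros := by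
  have h1 : symLayer (3 * s + 2) = {0} + (symRange 0 s + symRange s (2 * (s + 1))) := by
    rw [symLayer, show 3 * s + 2 = s + 2 * (s + 1) by ring, symRange_add, zero_add]
  have h2 : symLayer (3 * s + 2) =
      {0} + (symRange 0 (s + 1) + (symRange (s + 1) 1 + symRange (s + 2) (2 * s))) := by
    rw [symLayer, show 3 * s + 2 = (s + 1) + (1 + 2 * s) by ring, symRange_add, zero_add,
      symRange_add (s + 1)]
  have h3 : symLayer (3 * s + 2) + symLayer (3 * s + 2) =
      (symRange 0 (s + 1) + symRange s (2 * (s + 1))) + (symRange 0 s + symRange (s + 2) (2 * s)) +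
        ({0} + symRange (s + 1) 1) + {0} := by
    nth_rw 1 [h1]
    rw [h2]
    abel
  rw [h3]
  exact add_mem (zeroTriples_le (add_mem (add_mem (symRange_shuffle _ _) (symRange_shuffle _ _))
    (symRange_one_add_zero _))) zero_mem_zeroTriplesZeros

/-- The same exchange of upper parts, with the cuts at s+2 and s; now the top pair ±(3s+5) takes up
a zero. -/
theorem symLayer_add_next (s : ℕ) :
    symLayer (3 * s + 2) + symLayer (3 * s + 5) ∈ zeroTriplesZeros := by
  have h1 : symLayer (3 * s + 2) = {0} + (symRange 0 (s + 2) + symRange (s + 2) (2 * s)) := by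
    rw [symLayer, show 3 * s + 2 = (s + 2) + 2 * s by ring, symRange_add, zero_add]
  have h2 : symLayer (3 * s + 5) =
      {0} + (symRange 0 s + (symRange s (2 * (s + 2)) + symRange (s + 2 * (s + 2)) 1)) := by
    rw [symLayer, show 3 * s + 5 = s + (2 * (s + 2) + 1) by ring, symRange_add, symRange_add]
    simp only [zero_add]
  have h3 : symLayer (3 * s + 2) + symLayer (3 * s + 5) =
      (symRange 0 (s + 2) + symRange s (2 * (s + 2))) + (symRange 0 s + symRange (s + 2) (2 * s)) +
        ({0} + symRange (s + 2 * (s + 2)) 1) + {0} := by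
    rw [h1, h2]
    abel
  rw [h3]
  exact add_mem (zeroTriples_le (add_mem (add_mem (symRange_shuffle _ _) (symRange_shuffle _ _))
    (symRange_one_add_zero _))) zero_mem_zeroTriplesZeros

theorem AddSubmonoid.nsmul_mem_or_of_add_self_mem {A : Type*} [AddCommMonoid A]
    (H : AddSubmonoid A) {x : A} (hx : x + x ∈ H) (n : ℕ) :
    n • x ∈ H ∨ ∃ y ∈ H, n • x = y + x := by
  induction n with
  | zero => exact Or.inl (by simp [zero_mem])
  | succ n ih =>
    rcases ih with h | ⟨y, hy, h⟩
    · exact Or.inr ⟨_, h, succ_nsmul x n⟩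
    · refine Or.inl ?_
      rw [succ_nsmul, h, add_assoc]
      exact add_mem hy hx

/-- Only layers with index 2 mod 3 obstruct, and equal ones cancel in pairs. An odd copy left over
is merged with one copy of the next such layer, which exists because multiplicities are positive.
Hence at most one copy survives, of the last such layer below N. -/
theorem sum_symLayer_mem (μ : ℕ → ℕ) (N : ℕ) (hμ : ∀ m < N, 0 < μ m) :
    ∑ m ∈ Finset.range N, μ m • symLayer m ∈ zeroTriplesZeros ∨
      ∃ y ∈ zeroTriplesZeros, ∃ s, 3 * s + 2 < N ∧ N ≤ 3 * s + 5 ∧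
        ∑ m ∈ Finset.range N, μ m • symLayer m = y + symLayer (3 * s + 2) := by
  induction N with
  | zero => exact Or.inl (by simp [zero_mem])
  | succ N ih =>
    have ih := ih fun m hm => hμ m (by omega)
    rw [Finset.sum_range_succ]
    by_cases hN : N % 3 = 2
    · obtain ⟨t, rfl⟩ : ∃ t, N = 3 * t + 2 := ⟨N / 3, by omega⟩
      rcases ih with h | ⟨y, hy, s, hs1, hs2, h⟩
      · rcases AddSubmonoid.nsmul_mem_or_of_add_self_mem _ (symLayer_add_self t)
          (μ (3 * t + 2)) with h' | ⟨z, hz, h'⟩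
        · exact Or.inl (add_mem h h')
        · exact Or.inr ⟨_, add_mem h hz, t, by omega, by omega, by rw [h', add_assoc]⟩
      · obtain rfl : t = s + 1 := by omega
        obtain ⟨q, hq⟩ : ∃ q, μ (3 * (s + 1) + 2) = q + 1 :=
          ⟨_, (Nat.succ_pred_eq_of_pos (hμ _ (by omega))).symm⟩
        have e : ∑ m ∈ Finset.range (3 * (s + 1) + 2), μ m • symLayer m +
            μ (3 * (s + 1) + 2) • symLayer (3 * (s + 1) + 2) =
            y + (symLayer (3 * s + 2) + symLayer (3 * s + 5)) + q • symLayer (3 * (s + 1) + 2) := by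
          rw [h, hq, succ_nsmul, show 3 * (s + 1) + 2 = 3 * s + 5 by ring]
          abel
        rw [e]
        have h0 := add_mem hy (symLayer_add_next s)
        rcases AddSubmonoid.nsmul_mem_or_of_add_self_mem _ (symLayer_add_self (s + 1)) q with
          h' | ⟨z, hz, h'⟩
        · exact Or.inl (add_mem h0 h')
        · exact Or.inr ⟨_, add_mem h0 hz, s + 1, by omega, by omega, by rw [h']; abel⟩
    · have hL : symLayer N ∈ zeroTriplesZeros := by
        rcases (by omega : N % 3 = 0 ∨ N % 3 = 1) with h | h
        · rw [show N = 3 * (N / 3) by omega]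
          exact symLayer_three_mul _
        · rw [show N = 3 * (N / 3) + 1 by omega]
          exact symLayer_three_mul_add_one _
      have hL := nsmul_mem hL (μ N)
      rcases ih with h | ⟨y, hy, s, hs1, hs2, h⟩
      · exact Or.inl (add_mem h hL)
      · exact Or.inr ⟨_, add_mem hy hL, s, by omega, by omega, by rw [h]; abel⟩

/-! ### Stairs and their zero-sum groups -/

/-- Sums of the layers `{-m, …, m}` for `m < N`, each with positive multiplicity. -/
def IsStair (M : Multiset ℤ) : Prop :=
  ∃ (N : ℕ) (μ : ℕ → ℕ), (∀ m < N, 0 < μ m) ∧ M = ∑ m ∈ Finset.range N, μ m • symLayer m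

theorem zeroTriples_add_nsmul_zero {Z : Multiset ℤ} (hZ : Z ∈ zeroTriples) (n : ℕ) :
    ∃ Z' ∈ zeroTriples, ∃ L : Multiset ℤ, Multiset.card L ≤ 2 ∧ Z + n • {0} = Z' + L := by
  refine ⟨Z + (n / 3) • {0, 0, 0}, add_mem hZ (nsmul_mem (triple_mem_zeroTriples (by simp)) _),
    (n % 3) • {0}, by simp; omega, ?_⟩
  have : ({0, 0, 0} : Multiset ℤ) = 3 • {0} := by rfl
  rw [this, ← mul_nsmul, add_assoc, ← add_nsmul, Nat.div_add_mod]

theorem symLayer_succ (m : ℕ) :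
    symLayer (m + 1) = symLayer m + {((m : ℤ) + 1), -((m : ℤ) + 1)} := by
  rw [symLayer, symRange_add, symLayer, add_assoc]
  simp [symRange]

/-- A surviving layer 3s+2 is layer 3s+1, which splits, together with ±(3s+2). That pair joins a
spare zero if there is one and is itself the remainder otherwise; other spare zeros are grouped in
threes. -/
theorem IsStair.exists_zeroTriples {M : Multiset ℤ} (hM : IsStair M) :
    ∃ Z ∈ zeroTriples, ∃ L : Multiset ℤ, Multiset.card L ≤ 2 ∧ M = Z + L := by
  obtain ⟨N, μ, hμ, rfl⟩ := hM
  rcases sum_symLayer_mem μ N hμ with h | ⟨y, hy, s, -, -, h⟩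
  · obtain ⟨Z, hZ, n, h⟩ := mem_zeroTriplesZeros h
    rw [h]
    exact zeroTriples_add_nsmul_zero hZ n
  · rw [symLayer_succ, ← add_assoc] at h
    obtain ⟨Z, hZ, n, h'⟩ := mem_zeroTriplesZeros (add_mem hy (symLayer_three_mul_add_one s))
    rw [h, h']
    generalize ((3 * s + 1 : ℕ) : ℤ) + 1 = x
    rcases n with _ | n
    · exact ⟨Z, hZ, {x, -x}, by simp, by simp⟩
    · have ht : ({0, x, -x} : Multiset ℤ) ∈ zeroTriples := triple_mem_zeroTriples (by ring)
      obtain ⟨Z', hZ', L, hL, e⟩ := zeroTriples_add_nsmul_zero (add_mem hZ ht) n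
      refine ⟨Z', hZ', L, hL, ?_⟩
      rw [← e, succ_nsmul, show ({0, x, -x} : Multiset ℤ) = {0} + {x, -x} by rfl]
      abel

theorem IsStair.exists_three {M : Multiset ℤ} (hM : IsStair M) {p : ℕ}
    (hp : 3 * p ≤ Multiset.card M) :
    ∃ g : Fin p → Multiset ℤ, (∀ j, Multiset.card (g j) = 3 ∧ (g j).sum = 0) ∧ ∑ j, g j ≤ M := by
  obtain ⟨Z, hZ, L, hL, rfl⟩ := hM.exists_zeroTriples
  obtain ⟨l, hl, rfl⟩ := AddSubmonoid.exists_list_of_mem_closure hZ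
  have hc : Multiset.card l.sum = 3 * l.length := by
    clear hp hZ hM
    induction l with
    | nil => simp
    | cons t l ih =>
      simp only [List.sum_cons, Multiset.card_add, List.length_cons]
      rw [ih fun y hy => hl y (List.mem_cons_of_mem _ hy), (hl t List.mem_cons_self).1]
      ring
  have hlen : p ≤ l.length := by
    rw [Multiset.card_add, hc] at hp
    omega
  refine ⟨fun j => l.get (Fin.castLE hlen j), fun j => hl _ (List.get_mem _ _), ?_⟩
  refine le_trans ?_ (Multiset.le_add_right _ _)
  have e : ∑ j : Fin p, l.get (Fin.castLE hlen j) = (l.take p).sum := by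
    rw [← List.sum_ofFn]
    congr 1
    refine List.ext_getElem (by simp [hlen]) fun i h1 h2 => by simp
  rw [e]
  conv_rhs => rw [← List.take_append_drop p l, List.sum_append]
  exact Multiset.le_add_right _ _

/-- The top multiplicity may vanish, as happens when the last copy of the top layer is shortened. -/
theorem isStair_sum_range_succ (μ : ℕ → ℕ) (N : ℕ) (hμ : ∀ m < N, 0 < μ m) :
    IsStair (∑ m ∈ Finset.range (N + 1), μ m • symLayer m) := by
  rcases Nat.eq_zero_or_pos (μ N) with h | h
  · exact ⟨N, μ, hμ, by rw [Finset.sum_range_succ, h, zero_nsmul, add_zero]⟩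
  · exact ⟨N + 1, μ, fun m hm => (Nat.lt_succ_iff_lt_or_eq.1 hm).elim (hμ m) (by rintro rfl; exact h),
      rfl⟩

/-- Removing the extreme pair from one copy of the top layer turns it into a copy of the layer
below, so no gap arises. If only layer 0 is present, two zeros are removed. -/
theorem IsStair.exists_pair {M : Multiset ℤ} (hM : IsStair M) (h2 : 2 ≤ Multiset.card M) :
    ∃ (M' : Multiset ℤ) (x : ℤ), IsStair M' ∧ M = M' + {x, -x} := by
  obtain ⟨N, μ, hμ, rfl⟩ := hM
  rcases N with _ | _ | N
  · simp at h2
  · obtain ⟨q, hq⟩ : ∃ q, μ 0 = q + 2 :=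
      ⟨μ 0 - 2, by simp [symLayer, symRange] at h2; omega⟩
    refine ⟨_, 0, isStair_sum_range_succ (fun _ => q) 0 (by simp), ?_⟩
    simp only [zero_add, Finset.sum_range_one, hq, add_nsmul]
    rfl
  · obtain ⟨q, hq⟩ : ∃ q, μ (N + 1) = q + 1 :=
      ⟨_, (Nat.succ_pred_eq_of_pos (hμ _ (by omega))).symm⟩
    refine ⟨_, (N : ℤ) + 1, isStair_sum_range_succ
      (fun m => if m < N then μ m else if m = N then μ N + 1 else q) (N + 1) ?_, ?_⟩
    · intro m hm
      split_ifs with h1 h2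
      · exact hμ m (by omega)
      · omega
      · omega
    · rw [Finset.sum_range_succ, Finset.sum_range_succ, Finset.sum_range_succ (n := N + 1),
        Finset.sum_range_succ (n := N)]
      have e : ∑ m ∈ Finset.range N,
          (if m < N then μ m else if m = N then μ N + 1 else q) • symLayer m =
          ∑ m ∈ Finset.range N, μ m • symLayer m :=
        Finset.sum_congr rfl fun m hm => by rw [if_pos (Finset.mem_range.1 hm)]
      rw [e, hq]
      simp only [lt_irrefl, if_false, if_true, Nat.succ_ne_self, add_nsmul, one_nsmul,
        not_lt.2 (Nat.le_succ N)]
      nth_rw 2 [symLayer_succ]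
      abel

theorem IsStair.exists_pairs {M : Multiset ℤ} (hM : IsStair M) {p : ℕ}
    (hp : 2 * p ≤ Multiset.card M) :
    ∃ (M' : Multiset ℤ) (y : Fin p → ℤ), IsStair M' ∧
      M = M' + ∑ j, ({y j, -y j} : Multiset ℤ) := by
  induction p with
  | zero => exact ⟨M, Fin.elim0, hM, by simp⟩
  | succ p ih =>
    obtain ⟨M', y, hM', e⟩ := ih (by omega)
    have hc : Multiset.card M = Multiset.card M' + 2 * p := by
      rw [e]; simp [mul_comm]
    obtain ⟨M'', x, hM'', e'⟩ := hM'.exists_pair (by omega)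
    refine ⟨M'', Fin.cons x y, hM'', ?_⟩
    rw [e, e', Fin.sum_univ_succ]
    simp only [Fin.cons_zero, Fin.cons_succ]
    abel

/-- A stair with at least `(2 q + 3) p` elements contains `p` disjoint zero-sum multisets of size
`2 q + 3`. -/
theorem IsStair.exists_zero_sum {M : Multiset ℤ} (hM : IsStair M) {p : ℕ} (q : ℕ)
    (hp : (2 * q + 3) * p ≤ Multiset.card M) :
    ∃ g : Fin p → Multiset ℤ, (∀ j, Multiset.card (g j) = 2 * q + 3 ∧ (g j).sum = 0) ∧
      ∑ j, g j ≤ M := by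
  induction q generalizing M with
  | zero => exact hM.exists_three hp
  | succ q ih =>
    obtain ⟨M', y, hM', e⟩ := hM.exists_pairs (p := p) (by nlinarith)
    have hc : Multiset.card M = Multiset.card M' + 2 * p := by
      rw [e]; simp [mul_comm]
    obtain ⟨g, hg, hle⟩ := ih hM' (by nlinarith)
    refine ⟨fun j => g j + {y j, -y j}, fun j => ⟨?_, ?_⟩, ?_⟩
    · simp [(hg j).1]; ring
    · simp [(hg j).2]
    · rw [Finset.sum_add_distrib, e]
      gcongr

theorem count_symLayer (m : ℕ) (v : ℤ) :
    (symLayer m).count v = if v.natAbs ≤ m then 1 else 0 := by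
  induction m with
  | zero =>
    simp only [symLayer, symRange, Finset.range_zero, Finset.sum_empty, add_zero,
      Multiset.count_singleton]
    congr 1
    simp
  | succ m ih =>
    rw [symLayer_succ, Multiset.count_add, ih]
    simp only [Multiset.insert_eq_cons, Multiset.count_cons, Multiset.count_singleton]
    split_ifs <;> omega

/-- Telescoping: the layers containing a value of modulus a are those with m ≥ a, so multiplicities
f m - f (m+1) produce that value f a times when f N = 0. -/
theorem sum_range_sub_succ_add (f : ℕ → ℕ) (a N : ℕ) (hf : ∀ v < N, f (v + 1) ≤ f v) :
    ∑ m ∈ Finset.range N, (f m - f (m + 1)) * (if a ≤ m then 1 else 0) + f N =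
      if a ≤ N then f a else f N := by
  induction N with
  | zero =>
    rcases Nat.eq_zero_or_pos a with rfl | h
    · simp
    · simp [h.ne']
  | succ N ih =>
    have ih := ih fun v hv => hf v (by omega)
    have h := hf N (by omega)
    rw [Finset.sum_range_succ]
    rcases lt_trichotomy a (N + 1) with h1 | rfl | h1
    · rw [if_pos (by omega)] at ih
      rw [if_pos (by omega), if_pos (by omega)]
      omega
    · rw [if_neg (by omega)] at ih
      rw [if_neg (by omega), if_pos le_rfl]
      omega
    · rw [if_neg (by omega)] at ih
      rw [if_neg (by omega), if_neg (by omega)]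
      omega

/-- The symmetric multiset with multiplicity function `v ↦ f |v|` is a stair if `f` is strictly
decreasing until it vanishes. -/
theorem exists_isStair (f : ℕ → ℕ) (N : ℕ) (hf : ∀ v < N, f (v + 1) < f v) (hN : f N = 0) :
    ∃ M, IsStair M ∧ ∀ v : ℤ, M.count v = if v.natAbs ≤ N then f v.natAbs else 0 := by
  refine ⟨_, ⟨N, fun m => f m - f (m + 1), fun m hm => Nat.sub_pos_of_lt (hf m hm), rfl⟩,
    fun v => ?_⟩
  have := sum_range_sub_succ_add f v.natAbs N fun v hv => (hf v hv).le
  rw [hN, add_zero] at this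
  simp only [Multiset.count_sum', Multiset.count_nsmul, count_symLayer, this]

/-! ### Rounding fractional assignments -/

/-- Hall's theorem for a fractional matching. -/
theorem exists_injective_of_weights {β γ : Type*} [Fintype β] [Fintype γ] [DecidableEq γ]
    (w : β → γ → ℚ) (hw : ∀ x y, 0 ≤ w x y) (hrow : ∀ x, ∑ y, w x y = 1)
    (hcol : ∀ y, ∑ x, w x y ≤ 1) : ∃ f : β → γ, f.Injective ∧ ∀ x, 0 < w x (f x) := by
  have := (Finset.all_card_le_biUnion_card_iff_exists_injective
    (fun x => Finset.univ.filter fun y => 0 < w x y)).1 ?_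
  · obtain ⟨f, hf, h⟩ := this
    exact ⟨f, hf, fun x => by simpa using h x⟩
  -- Hall's condition: the rows in A send total weight |A| to their neighbours, each of which
  -- receives at most 1.
  · intro A
    have h1 : ∀ x ∈ A, ∑ y ∈ A.biUnion fun x => Finset.univ.filter fun y => 0 < w x y, w x y =
        1 := by
      intro x hx
      rw [← hrow x]
      refine Finset.sum_subset (Finset.subset_univ _) fun y _ hy => ?_
      by_contra h
      exact hy (Finset.mem_biUnion.2 ⟨x, hx, by simpa using lt_of_le_of_ne (hw x y) (Ne.symm h)⟩)
    have h2 := Finset.sum_congr rfl h1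
    rw [Finset.sum_comm, Finset.sum_const, nsmul_eq_mul, mul_one] at h2
    have h3 : ∑ y ∈ A.biUnion (fun x => Finset.univ.filter fun y => 0 < w x y), ∑ x ∈ A, w x y ≤
        ∑ y ∈ A.biUnion (fun x => Finset.univ.filter fun y => 0 < w x y), (1 : ℚ) :=
      Finset.sum_le_sum fun y _ => (Finset.sum_le_sum_of_subset_of_nonneg (Finset.subset_univ _)
        fun x _ _ => hw x y).trans (hcol y)
    rw [h2, Finset.sum_const, nsmul_eq_mul, mul_one] at h3
    exact_mod_cast h3

/-- A system of distinct representatives that rounds a fractional assignment: every `a` is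
assigned some `b` with `0 < W a b`, and the number of `a` assigned to `b` lies between the integer
bounds `lo b` and `up b` of the column sum of `b`. -/
theorem exists_rounded_assignment {α β : Type*} [Fintype α] [Fintype β] [DecidableEq β]
    (W : α → β → ℚ) (lo up : β → ℕ) (hW : ∀ a b, 0 ≤ W a b) (hrow : ∀ a, ∑ b, W a b = 1)
    (hlo : ∀ b, (lo b : ℚ) ≤ ∑ a, W a b) (hup : ∀ b, ∑ a, W a b ≤ up b) :
    ∃ g : α → β, (∀ a, 0 < W a (g a)) ∧
      ∀ b, lo b ≤ (Finset.univ.filter fun a => g a = b).card ∧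
        (Finset.univ.filter fun a => g a = b).card ≤ up b := by
  classical
  set S : β → ℚ := fun b => ∑ a, W a b with hS
  have hS0 : ∀ b, 0 ≤ S b := fun b => Finset.sum_nonneg fun a _ => hW a b
  have hlu : ∀ b, lo b ≤ up b := fun b => by exact_mod_cast (hlo b).trans (hup b)
  -- Each b is split into `up b` slots: `lo b` mandatory ones of weight 1, the others sharing the
  -- rest of the column sum equally. If the denominator is 0, all slots are mandatory.
  set s : (Σ b, Fin (up b)) → ℚ := fun x =>
    if (x.2 : ℕ) < lo x.1 then 1 else (S x.1 - lo x.1) / (up x.1 - lo x.1) with hs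
  have hs0 : ∀ x, 0 ≤ s x := by
    intro x
    simp only [hs]
    split_ifs
    · exact zero_le_one
    · exact div_nonneg (sub_nonneg.2 (hlo _)) (sub_nonneg.2 (by exact_mod_cast hlu _))
  have hs1 : ∀ x, s x ≤ 1 := by
    intro x
    simp only [hs]
    split_ifs
    · exact le_rfl
    · exact div_le_one_of_le₀ (sub_le_sub_right (hup _) _)
        (sub_nonneg.2 (by exact_mod_cast hlu _))
  have hsS : ∀ b, ∑ i, s ⟨b, i⟩ = S b := by
    intro b
    simp only [hs]
    rw [Fin.sum_univ_eq_sum_range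
      (fun i => if i < lo b then (1 : ℚ) else (S b - lo b) / (up b - lo b)) (up b),
      ← Finset.sum_range_add_sum_Ico _ (hlu b),
      Finset.sum_congr rfl (g := fun _ => (1 : ℚ)) (fun i hi => if_pos (Finset.mem_range.1 hi)),
      Finset.sum_congr rfl (s₁ := Finset.Ico _ _) (g := fun _ => (S b - lo b) / (up b - lo b))
        (fun i hi => if_neg (not_lt.2 (Finset.mem_Ico.1 hi).1))]
    simp only [Finset.sum_const, Finset.card_range, Nat.card_Ico, nsmul_eq_mul, mul_one]
    rw [Nat.cast_sub (hlu b)]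
    rcases (hlu b).eq_or_lt with h | h
    · have h1 := hlo b
      have h2 := hup b
      rw [← h] at h2
      rw [h, sub_self, zero_mul, add_zero, ← h]
      exact le_antisymm h1 h2
    · have : (up b : ℚ) - lo b ≠ 0 := sub_ne_zero.2 (by exact_mod_cast h.ne')
      field_simp
      ring
  have htot : ∑ x, s x = Fintype.card α := by
    rw [Fintype.sum_sigma, Finset.sum_congr rfl fun b _ => hsS b, hS, Finset.sum_comm,
      Finset.sum_congr rfl fun a _ => hrow a]
    simp
  have hcard : Fintype.card α ≤ Fintype.card (Σ b, Fin (up b)) := by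
    have : ∑ x, s x ≤ ∑ _x : (Σ b, Fin (up b)), (1 : ℚ) := Finset.sum_le_sum fun x _ => hs1 x
    rw [htot] at this
    rw [Finset.sum_const, Finset.card_univ, nsmul_eq_mul, mul_one] at this
    exact_mod_cast this
  obtain ⟨d, hd⟩ := Nat.exists_eq_add_of_le hcard
  have hδ : ∑ x, (1 - s x) = d := by
    rw [Finset.sum_sub_distrib, htot, Finset.sum_const, Finset.card_univ, hd]
    simp
  have hW0 : ∀ a b, S b = 0 → W a b = 0 := fun a b h =>
    (Finset.sum_eq_zero_iff_of_nonneg fun a _ => hW a b).1 h a (Finset.mem_univ a)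
  -- Slots are matched to elements of α or to d dummies that absorb the deficits 1 - s x. A
  -- mandatory slot has weight 0 on dummies, so it meets a genuine element; this gives the lower
  -- bound.
  obtain ⟨f, hf, hpos⟩ := exists_injective_of_weights (γ := α ⊕ Fin d)
    (fun x y => Sum.elim (fun a => W a x.1 * s x / S x.1) (fun _ => (1 - s x) / d) y)
    (by
      rintro x (a | i)
      · exact div_nonneg (mul_nonneg (hW _ _) (hs0 _)) (hS0 _)
      · exact div_nonneg (sub_nonneg.2 (hs1 x)) (Nat.cast_nonneg _))
    (by
      intro x
      rw [Fintype.sum_sum_type]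
      simp only [Sum.elim_inl, Sum.elim_inr, Finset.sum_const, Finset.card_univ, Fintype.card_fin,
        nsmul_eq_mul]
      rw [← Finset.sum_div, ← Finset.sum_mul]
      have h1 : (∑ a, W a x.1) * s x / S x.1 = s x := by
        rcases (hS0 x.1).eq_or_lt with h | h
        · have h' := hsS x.1
          rw [← h, Finset.sum_eq_zero_iff_of_nonneg fun i _ => hs0 _] at h'
          rw [h' x.2 (Finset.mem_univ _)]
          simp
        · exact mul_div_cancel_left₀ _ h.ne'
      have h2 : (d : ℚ) * ((1 - s x) / d) = 1 - s x := by
        rcases Nat.eq_zero_or_pos d with rfl | h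
        · rw [Nat.cast_zero, Finset.sum_eq_zero_iff_of_nonneg fun x _ => sub_nonneg.2 (hs1 x)] at hδ
          rw [hδ x (Finset.mem_univ _)]
          simp
        · exact mul_div_cancel₀ _ (by exact_mod_cast h.ne')
      rw [h1, h2]
      ring)
    (by
      rintro (a | i)
      · simp only [Sum.elim_inl]
        rw [Fintype.sum_sigma, ← hrow a]
        refine le_of_eq (Finset.sum_congr rfl fun b _ => ?_)
        simp only
        rw [← Finset.sum_div, ← Finset.mul_sum, hsS]
        rcases (hS0 b).eq_or_lt with h | h
        · rw [hW0 a b h.symm]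
          simp
        · exact mul_div_cancel_right₀ _ h.ne'
      · simp only [Sum.elim_inr]
        rw [← Finset.sum_div, hδ]
        exact div_self_le_one _)
  have hbij : Function.Bijective f := by
    rw [Fintype.bijective_iff_injective_and_card]
    exact ⟨hf, by simp [hd]⟩
  choose e he using fun a => hbij.2 (Sum.inl a)
  have heinj : Function.Injective e := fun a a' h => by
    have := he a
    rw [h, he a'] at this
    exact (Sum.inl.inj this).symm
  refine ⟨fun a => (e a).1, fun a => ?_, fun b => ⟨?_, ?_⟩⟩
  · have h := hpos (e a)
    rw [he a, Sum.elim_inl] at h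
    refine (hW _ _).lt_of_ne fun h0 => ?_
    rw [← h0] at h
    simp at h
  · have h : ∀ i : Fin (lo b), ∃ a, f ⟨b, Fin.castLE (hlu b) i⟩ = Sum.inl a := by
      intro i
      rcases h : f ⟨b, Fin.castLE (hlu b) i⟩ with a | j
      · exact ⟨a, rfl⟩
      · have h' := hpos ⟨b, Fin.castLE (hlu b) i⟩
        rw [h, Sum.elim_inr] at h'
        simp [hs] at h'
    choose a ha using h
    have hea : ∀ i, e (a i) = ⟨b, Fin.castLE (hlu b) i⟩ := fun i => hf ((he _).trans (ha i).symm)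
    have := Finset.card_le_card_of_injOn (s := Finset.univ)
      (t := Finset.univ.filter fun a => (e a).1 = b) a (fun i _ => by simp [hea i])
      (fun i _ j _ hij => by
        have := ha i
        rw [hij, ← ha j] at this
        simpa using hf this)
    simpa using this
  · rw [← Finset.card_image_of_injective _ heinj]
    refine (Finset.card_le_card (t := Finset.univ.map (Function.Embedding.sigmaMk b)) ?_).trans
      (by simp)
    intro x hx
    obtain ⟨a, ha, rfl⟩ := Finset.mem_image.1 hx
    have ha : (e a).1 = b := by simpa using ha
    subst ha
    simp

/-! ### Baranyai-type theorems -/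

/-- A Baranyai-type theorem. In each of `p` systems the sizes `a j i` sum to `|S|`; if every pair of
a label `t` and a size `x` occurs at most `(|S| choose x) * K t` times, then the sizes are realised
by partitions of `S` in which every pair of a label `t` and a set occurs at most `K t` times. -/
theorem exists_label_partition {V κ : Type*} [DecidableEq V] [Fintype κ] [DecidableEq κ] {p : ℕ}
    (S : Finset V) {Λ : Type} [Fintype Λ] [DecidableEq Λ] (K : Λ → ℕ)
    (l : Fin p → κ → Λ) (a : Fin p → κ → ℕ) (ha : ∀ j, ∑ i, a j i = S.card)
    (hK : ∀ t x, (Finset.univ.filter fun e : Fin p × κ => l e.1 e.2 = t ∧ a e.1 e.2 = x).card ≤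
      S.card.choose x * K t) :
    ∃ T : Fin p → κ → Finset V, (∀ j i, T j i ⊆ S) ∧ (∀ j i, (T j i).card = a j i) ∧
      (∀ j, ∀ v ∈ S, ∃! i, v ∈ T j i) ∧
      ∀ t s, (Finset.univ.filter fun e : Fin p × κ => l e.1 e.2 = t ∧ T e.1 e.2 = s).card ≤ K t := by
  induction S using Finset.induction_on generalizing Λ a with
  | empty =>
    refine ⟨fun _ _ => ∅, by simp, fun j i => ?_, by simp, fun t s => ?_⟩
    · have := ha j
      simp only [Finset.card_empty, Finset.sum_eq_zero_iff, Finset.mem_univ, true_imp_iff] at this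
      simp [this i]
    · refine le_trans (Finset.card_le_card ?_) ((hK t 0).trans (by simp))
      intro e he
      simp only [Finset.mem_filter, Finset.mem_univ, true_and] at he ⊢
      have := ha e.1
      simp only [Finset.card_empty, Finset.sum_eq_zero_iff, Finset.mem_univ, true_imp_iff] at this
      exact ⟨he.1, this e.2⟩
  | insert v S hv ih =>
    rw [Finset.card_insert_of_notMem hv] at ha hK
    set u := S.card with hu
    have hu0 : (0 : ℚ) < u + 1 := by positivity
    have ha' : ∀ j i, a j i < u + 2 := fun j i => by
      have := Finset.single_le_sum (f := a j) (fun _ _ => Nat.zero_le _) (Finset.mem_univ i)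
      rw [ha j] at this
      omega
    let ty : Fin p → κ → Λ × Fin (u + 2) := fun j i => (l j i, ⟨a j i, ha' j i⟩)
    let N : Λ → ℕ → ℕ := fun t x =>
      (Finset.univ.filter fun e : Fin p × κ => l e.1 e.2 = t ∧ a e.1 e.2 = x).card
    -- Under a uniformly random completion, the new point would lie in a class of size x with
    -- probability x/(u+1).
    let W : Fin p → Λ × Fin (u + 2) → ℚ := fun j b =>
      ∑ i, if ty j i = b then (a j i : ℚ) / (u + 1) else 0
    have hcol : ∀ b : Λ × Fin (u + 2), ∑ j, W j b = N b.1 b.2 * (b.2 : ℚ) / (u + 1) := by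
      intro b
      rw [← Fintype.sum_prod_type' (fun j i => if ty j i = b then (a j i : ℚ) / (u + 1) else 0),
        ← Finset.sum_filter]
      have e : (Finset.univ.filter fun e : Fin p × κ => ty e.1 e.2 = b) =
          Finset.univ.filter fun e : Fin p × κ => l e.1 e.2 = b.1 ∧ a e.1 e.2 = b.2 := by
        ext e
        simp [ty, Prod.ext_iff, Fin.ext_iff]
      rw [e, Finset.sum_congr rfl (g := fun _ => (b.2 : ℚ) / (u + 1)), Finset.sum_const,
        nsmul_eq_mul, mul_div_assoc]
      intro e he
      rw [(Finset.mem_filter.1 he).2.2]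
    -- Of the N classes of type (t, x), at most (u choose x-1) K t may receive v and at most (u
    -- choose x) K t may avoid it. The fractional column sum N x/(u+1) satisfies both bounds.
    obtain ⟨g, hg, hgb⟩ := exists_rounded_assignment W
      (fun b => N b.1 b.2 - u.choose b.2 * K b.1)
      (fun b => if (b.2 : ℕ) = 0 then 0 else u.choose (b.2 - 1) * K b.1)
      (fun j b => Finset.sum_nonneg fun i _ => by split_ifs <;> positivity)
      (fun j => by
        rw [Finset.sum_comm]
        simp only [Finset.sum_ite_eq, Finset.mem_univ, if_true]
        rw [← Finset.sum_div, ← Nat.cast_sum, ha j]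
        push_cast
        exact div_self hu0.ne')
      (fun b => by
        rw [hcol, le_div_iff₀ hu0]
        have h1 := hK b.1 b.2
        have h2 := Nat.choose_mul_succ_eq u b.2
        obtain ⟨d, hd⟩ : ∃ d, u + 1 = b.2 + d := ⟨u + 1 - b.2, by have := b.2.2; omega⟩
        rw [show u + 1 - (b.2 : ℕ) = d by omega] at h2
        rcases Nat.le_total (N b.1 b.2) (u.choose b.2 * K b.1) with h | h
        · rw [Nat.sub_eq_zero_of_le h]
          simp only [Nat.cast_zero, zero_mul]
          positivity
        · obtain ⟨q, hq⟩ := Nat.exists_eq_add_of_le h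
          rw [hq, Nat.add_sub_cancel_left]
          have h3 : N b.1 b.2 * d ≤ u.choose b.2 * K b.1 * (u + 1) :=
            calc _ ≤ (u + 1).choose b.2 * K b.1 * d := Nat.mul_le_mul_right _ h1
              _ = u.choose b.2 * (u + 1) * K b.1 := by rw [h2]; ring
              _ = _ := by ring
          rw [hq] at h3
          have h4 : q * (u + 1) ≤ (u.choose b.2 * K b.1 + q) * b.2 := by
            rw [hd] at h3 ⊢
            nlinarith
          exact_mod_cast h4)
      (fun b => by
        rw [hcol, div_le_iff₀ hu0]
        have h1 := hK b.1 b.2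
        rcases h : (b.2 : ℕ) with _ | y
        · simp
        · rw [h] at h1
          have h2 := Nat.add_one_mul_choose_eq u y
          have h3 : N b.1 (y + 1) * (y + 1) ≤ u.choose y * K b.1 * (u + 1) :=
            calc _ ≤ (u + 1).choose (y + 1) * K b.1 * (y + 1) := Nat.mul_le_mul_right _ h1
              _ = (u + 1).choose (y + 1) * (y + 1) * K b.1 := by ring
              _ = _ := by rw [← h2]; ring
          simp only [Nat.add_one_ne_zero, if_false, Nat.add_sub_cancel]
          exact_mod_cast h3)
    have hch : ∀ j, ∃ i, ty j i = g j ∧ 0 < a j i := by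
      intro j
      obtain ⟨i, -, hi⟩ := Finset.exists_lt_of_sum_lt (f := fun _ => (0 : ℚ)) (s := Finset.univ)
        (g := fun i => if ty j i = g j then (a j i : ℚ) / (u + 1) else 0) (by simpa using hg j)
      split_ifs at hi with h
      · refine ⟨i, h, ?_⟩
        by_contra h0
        simp [Nat.eq_zero_of_not_pos h0] at hi
      · simp at hi
    choose i₀ hi₀ hi₀' using hch
    -- The label now also records whether the class contains v, so that the capacity K t survives
    -- for each set with and without v.
    obtain ⟨T, hTS, hTc, hTp, hTK⟩ := ih (Λ := Λ × Bool) (fun t => K t.1)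
      (fun j i => (l j i, decide (i = i₀ j))) (fun j i => if i = i₀ j then a j i - 1 else a j i)
      (fun j => by
        have h1 := ha j
        rw [← Finset.add_sum_erase _ _ (Finset.mem_univ (i₀ j))] at h1 ⊢
        rw [if_pos rfl, Finset.sum_congr (s₂ := Finset.univ.erase (i₀ j)) rfl (g := fun i => a j i)]
        · have := hi₀' j
          omega
        · intro i hi
          rw [if_neg (Finset.ne_of_mem_erase hi)])
      (by
        rintro ⟨t, β⟩ x
        cases β
        · simp only [Prod.mk.injEq, decide_eq_false_iff_not]
          by_cases hx : x < u + 2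
          · have h1 := (hgb (t, ⟨x, hx⟩)).1
            have h2 : (Finset.univ.filter fun j => g j = (t, ⟨x, hx⟩)).card ≤
                (Finset.univ.filter fun e : Fin p × κ =>
                  (l e.1 e.2 = t ∧ a e.1 e.2 = x) ∧ e.2 = i₀ e.1).card := by
              refine Finset.card_le_card_of_injOn (fun j => (j, i₀ j)) ?_ ?_
              · intro j hj
                have hj : g j = (t, ⟨x, hx⟩) := by simpa using hj
                have := hi₀ j
                rw [hj] at this
                simpa [ty, Prod.ext_iff] using this
              · intro j _ j' _ h
                exact (Prod.ext_iff.1 h).1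
            have h3 := Finset.card_filter_add_card_filter_not
              (s := Finset.univ.filter fun e : Fin p × κ => l e.1 e.2 = t ∧ a e.1 e.2 = x)
              (fun e => e.2 = i₀ e.1)
            rw [Finset.filter_filter, Finset.filter_filter] at h3
            have h4 : (Finset.univ.filter fun e : Fin p × κ => (l e.1 e.2 = t ∧ ¬e.2 = i₀ e.1) ∧
                (if e.2 = i₀ e.1 then a e.1 e.2 - 1 else a e.1 e.2) = x) =
                Finset.univ.filter fun e : Fin p × κ =>
                  (l e.1 e.2 = t ∧ a e.1 e.2 = x) ∧ ¬e.2 = i₀ e.1 := by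
              refine Finset.filter_congr fun e _ => ?_
              by_cases h : e.2 = i₀ e.1 <;> simp [h]
            rw [h4]
            change N t x - _ ≤ _ at h1
            change _ = N t x at h3
            simp only at h1 ⊢
            omega
          · rw [Finset.filter_eq_empty_iff.2]
            · simp
            · rintro e - ⟨⟨-, h⟩, h'⟩
              rw [if_neg h] at h'
              exact hx (h' ▸ ha' _ _)
        · simp only [Prod.mk.injEq, decide_eq_true_eq]
          by_cases hx : x + 1 < u + 2
          · refine le_trans ?_ (hgb (t, ⟨x + 1, hx⟩)).2
            refine Finset.card_le_card_of_injOn Prod.fst ?_ ?_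
            · rintro ⟨j, i⟩ he
              simp only [Finset.coe_filter, Finset.mem_univ, true_and, Set.mem_ofPred_eq] at he
              obtain ⟨⟨h1, rfl⟩, h2⟩ := he
              have := hi₀' j
              rw [if_pos rfl] at h2
              have h3 := hi₀ j
              simp only [Finset.coe_filter, Finset.mem_univ, true_and, Set.mem_ofPred_eq]
              rw [← h3]
              simp only [ty, Prod.mk.injEq, Fin.mk.injEq]
              exact ⟨h1, by omega⟩
            · rintro ⟨j, i⟩ he ⟨j', i'⟩ he' h
              simp only [Finset.coe_filter, Finset.mem_univ, true_and, Set.mem_ofPred_eq] at he he' h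
              subst h
              rw [he.1.2, he'.1.2]
          · rw [Finset.filter_eq_empty_iff.2]
            · simp
            · rintro ⟨j, i⟩ - ⟨⟨-, h⟩, h'⟩
              have := ha' j i
              have := hi₀' j
              dsimp only at h h'
              subst h
              rw [if_pos rfl] at h'
              omega)
    have hvT : ∀ j i, v ∉ T j i := fun j i h => hv (hTS j i h)
    refine ⟨fun j i => if i = i₀ j then insert v (T j i) else T j i, ?_, ?_, ?_, ?_⟩
    · intro j i
      dsimp only
      split_ifs
      · exact Finset.insert_subset_insert _ (hTS j i)
      · exact (hTS j i).trans (Finset.subset_insert _ _)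
    · intro j i
      have := hTc j i
      dsimp only
      split_ifs with h
      · subst h
        rw [Finset.card_insert_of_notMem (hvT _ _), this, if_pos rfl]
        have := hi₀' j
        omega
      · rw [this, if_neg h]
    · intro j x hx
      by_cases hxv : x = v
      · subst hxv
        refine ⟨i₀ j, by simp, fun i hi => ?_⟩
        by_contra h
        simp [h, hvT] at hi
      · obtain ⟨i, hi, hu⟩ := hTp j x ((Finset.mem_insert.1 hx).resolve_left hxv)
        refine ⟨i, ?_, fun i' hi' => hu i' ?_⟩
        · dsimp only
          split_ifs <;> simp [hi]
        · dsimp only at hi'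
          split_ifs at hi' <;> simpa [hxv] using hi'
    · intro t s
      refine le_trans (Finset.card_le_card ?_) (hTK (t, decide (v ∈ s)) (s.erase v))
      intro e he
      simp only [Finset.mem_filter, Finset.mem_univ, true_and, Prod.mk.injEq, decide_eq_decide]
        at he ⊢
      obtain ⟨h1, rfl⟩ := he
      refine ⟨⟨h1, ?_⟩, ?_⟩
      · split_ifs with h <;> simp [h, hvT]
      · split_ifs with h <;> simp [hvT]

/-- Baranyai-type theorem for a ground set with two parts: intersection sizes with the parts that
respect the numbers of available sets are realised by partitions with pairwise distinct classes. -/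
theorem exists_bipartite_partition {V κ : Type} [Fintype V] [DecidableEq V] [Fintype κ]
    [DecidableEq κ] {p : ℕ} (S₁ S₂ : Finset V) (hS : Disjoint S₁ S₂) (hSu : S₁ ∪ S₂ = Finset.univ)
    (a b : Fin p → κ → ℕ) (ha : ∀ j, ∑ i, a j i = S₁.card) (hb : ∀ j, ∑ i, b j i = S₂.card)
    (hab : ∀ x y, (Finset.univ.filter fun e : Fin p × κ => a e.1 e.2 = x ∧ b e.1 e.2 = y).card ≤
      S₁.card.choose x * S₂.card.choose y) :
    ∃ T : Fin p → κ → Finset V, (∀ j i, (T j i ∩ S₁).card = a j i) ∧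
      (∀ j i, (T j i ∩ S₂).card = b j i) ∧ (∀ j, ∀ v, ∃! i, v ∈ T j i) ∧
      ∀ j i j' i', T j i = T j' i' → j = j' ∧ i = i' := by
  have hb' : ∀ j i, b j i < S₂.card + 1 := fun j i => by
    have := Finset.single_le_sum (f := b j) (fun _ _ => Nat.zero_le _) (Finset.mem_univ i)
    rw [hb j] at this
    omega
  -- On S₁ the label is the size of the future trace on S₂, and the capacity is the number of such
  -- traces. On S₂ the label is the trace already built and the capacity is 1, which forces distinct
  -- classes.
  obtain ⟨T₁, hT₁, hc₁, hp₁, hK₁⟩ := exists_label_partition S₁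
    (fun t : Fin (S₂.card + 1) => S₂.card.choose t)
    (fun j i => (⟨b j i, hb' j i⟩ : Fin (S₂.card + 1))) a ha (by
      intro t x
      refine le_trans (Finset.card_le_card ?_) (hab x t)
      intro e he
      simp only [Finset.mem_filter, Finset.mem_univ, true_and, Fin.ext_iff] at he ⊢
      exact ⟨he.2, he.1⟩)
  obtain ⟨T₂, hT₂, hc₂, hp₂, hK₂⟩ := exists_label_partition S₂ (fun _ => 1) T₁ b hb (by
    intro s y
    by_cases hy : y < S₂.card + 1
    · refine le_trans (Finset.card_le_card ?_) ((hK₁ ⟨y, hy⟩ s).trans (by simp))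
      intro e he
      simp only [Finset.mem_filter, Finset.mem_univ, true_and, Fin.ext_iff] at he ⊢
      exact ⟨he.2, he.1⟩
    · rw [Finset.filter_eq_empty_iff.2]
      · simp
      · rintro e - ⟨-, rfl⟩
        exact hy (hb' _ _))
  have e₁ : ∀ j i, (T₁ j i ∪ T₂ j i) ∩ S₁ = T₁ j i := fun j i => by
    rw [Finset.union_inter_distrib_right, Finset.inter_eq_left.2 (hT₁ j i),
      Finset.disjoint_iff_inter_eq_empty.1 (hS.symm.mono_left (hT₂ j i)), Finset.union_empty]
  have e₂ : ∀ j i, (T₁ j i ∪ T₂ j i) ∩ S₂ = T₂ j i := fun j i => by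
    rw [Finset.union_inter_distrib_right, Finset.inter_eq_left.2 (hT₂ j i),
      Finset.disjoint_iff_inter_eq_empty.1 (hS.mono_left (hT₁ j i)), Finset.empty_union]
  refine ⟨fun j i => T₁ j i ∪ T₂ j i, fun j i => by rw [e₁, hc₁], fun j i => by rw [e₂, hc₂], ?_,
    ?_⟩
  · intro j v
    rcases Finset.mem_union.1 (hSu ▸ Finset.mem_univ v : v ∈ S₁ ∪ S₂) with hv | hv
    · have : ∀ i, v ∉ T₂ j i := fun i h => Finset.disjoint_left.1 hS hv (hT₂ j i h)
      simpa [this] using hp₁ j v hv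
    · have : ∀ i, v ∉ T₁ j i := fun i h => Finset.disjoint_left.1 hS (hT₁ j i h) hv
      simpa [this] using hp₂ j v hv
  · intro j i j' i' h
    dsimp only at h
    have h₁ : T₁ j i = T₁ j' i' := by rw [← e₁ j i, h, e₁]
    have h₂ : T₂ j i = T₂ j' i' := by rw [← e₂ j i, h, e₂]
    have := Finset.card_le_one.1 (hK₂ (T₁ j' i') (T₂ j' i')) (j, i) (by simp [h₁, h₂])
      (j', i') (by simp)
    exact Prod.ext_iff.1 this

/-! ### Choosing the intersection sizes -/

theorem exists_choice_of_card_le {ι : Type*} [Fintype ι] (s : Finset ℕ) (F : ℕ → ℕ)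
    (h : Fintype.card ι ≤ ∑ i ∈ s, F i) :
    ∃ t : ι → ℕ, (∀ e, t e ∈ s) ∧ ∀ x, (Finset.univ.filter fun e => t e = x).card ≤ F x := by
  obtain ⟨φ⟩ : Nonempty (ι ↪ Σ i : s, Fin (F i)) :=
    Function.Embedding.nonempty_of_card_le (by
      rw [Fintype.card_sigma]
      simpa [Finset.sum_attach s F] using h)
  refine ⟨fun e => (φ e).1, fun e => (φ e).1.2, fun x => ?_⟩
  by_cases hx : x ∈ s
  · rw [← Finset.card_map φ]
    refine (Finset.card_le_card
      (t := Finset.univ.map (Function.Embedding.sigmaMk (⟨x, hx⟩ : s))) ?_).trans (by simp)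
    intro y hy
    obtain ⟨e, he, rfl⟩ := Finset.mem_map.1 hy
    have he : ((φ e).1 : ℕ) = x := by simpa using he
    subst he
    simp
  · rw [Finset.filter_eq_empty_iff.2]
    · simp
    · rintro e - rfl
      exact hx (φ e).1.2

theorem exists_zero_sum_functions {M : Multiset ℤ} {p r : ℕ} (g : Fin p → Multiset ℤ)
    (hg : ∀ j, Multiset.card (g j) = r ∧ (g j).sum = 0) (hle : ∑ j, g j ≤ M) :
    ∃ x : Fin p → Fin r → ℤ, (∀ j, ∑ i, x j i = 0) ∧
      ∀ v, (Finset.univ.filter fun e : Fin p × Fin r => x e.1 e.2 = v).card ≤ M.count v := by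
  have : ∀ j, ∃ x : Fin r → ℤ, Finset.univ.val.map x = g j := by
    intro j
    obtain ⟨l, hl⟩ := Quot.exists_rep (g j)
    have hl : (l : Multiset ℤ) = g j := hl
    obtain rfl : l.length = r := by rw [← (hg j).1, ← hl, Multiset.coe_card]
    exact ⟨l.get, by rw [Fin.univ_val_map, List.ofFn_get, hl]⟩
  choose x hx using this
  refine ⟨x, fun j => ?_, fun v => ?_⟩
  · rw [← (hg j).2, ← hx]
    rfl
  · refine le_trans (le_of_eq ?_) (Multiset.count_le_of_le v hle)
    rw [Multiset.count_sum', Finset.card_filter, Fintype.sum_prod_type]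
    refine Finset.sum_congr rfl fun j _ => ?_
    rw [← hx, Multiset.count_map, ← Finset.card_filter]
    simp only [eq_comm]
    rfl

/-- The ratios of consecutive binomial coefficients strictly decrease. With A = h+v, B = h-v this
makes the supply of types strictly decreasing in |v|, as a stair needs. -/
theorem choose_mul_choose_lt {m A B : ℕ} (hB : 0 < B) (hBA : B ≤ A) (hA : A < m) :
    m.choose (A + 1) * m.choose (B - 1) < m.choose A * m.choose B := by
  obtain ⟨B, rfl⟩ : ∃ b, B = b + 1 := ⟨B - 1, by omega⟩
  rw [Nat.add_sub_cancel]
  have h1 := Nat.choose_succ_right_eq m A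
  have h2 := Nat.choose_succ_right_eq m B
  have h3 : 0 < m.choose A := Nat.choose_pos hA.le
  have h4 : 0 < m.choose (B + 1) := Nat.choose_pos (by omega)
  have h5 : (m - A) * (B + 1) < (A + 1) * (m - B) :=
    calc (m - A) * (B + 1) ≤ (m - A) * (A + 1) := Nat.mul_le_mul_left _ (by omega)
      _ < (m - B) * (A + 1) := Nat.mul_lt_mul_of_pos_right (by omega) (by omega)
      _ = _ := mul_comm _ _
  refine Nat.lt_of_mul_lt_mul_right (a := (A + 1) * (m - B)) ?_
  calc m.choose (A + 1) * m.choose B * ((A + 1) * (m - B))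
      = (m.choose (A + 1) * (A + 1)) * (m.choose B * (m - B)) := by ring
    _ = (m.choose A * m.choose (B + 1)) * ((m - A) * (B + 1)) := by rw [h1, ← h2]; ring
    _ < _ := Nat.mul_lt_mul_of_pos_left h5 (Nat.mul_pos h3 h4)

/-- Deviations from the balanced type `(h, h)` for `p` groups of `r` sets of size `2 h`, with sum
zero in each group, that respect the number of available sets of each type. -/
theorem exists_balanced_choice {m h w p r : ℕ} (hw : w < h) (hm : h + w ≤ m) (hr : Odd r)
    (hr1 : r = 1 → w = 0)
    (hp : p * r ≤ ∑ i ∈ Finset.Icc (h - w) (h + w), m.choose i * m.choose (2 * h - i)) :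
    ∃ x : Fin p → Fin r → ℤ, (∀ j, ∑ i, x j i = 0) ∧ (∀ j i, (x j i).natAbs ≤ w) ∧
      ∀ v : ℤ, (Finset.univ.filter fun e : Fin p × Fin r => x e.1 e.2 = v).card ≤
        m.choose (h + v.natAbs) * m.choose (h - v.natAbs) := by
  obtain ⟨q, rfl⟩ := hr
  rcases q with _ | q
  · obtain rfl := hr1 rfl
    refine ⟨fun _ _ => 0, by simp, by simp, fun v => ?_⟩
    by_cases hv : v = 0
    · subst hv
      simpa [two_mul] using hp
    · simp [Ne.symm hv]
  · set f : ℕ → ℕ := fun v => if v ≤ w then m.choose (h + v) * m.choose (h - v) else 0 with hf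
    obtain ⟨M, hM, hc⟩ := exists_isStair f (w + 1)
      (by
        intro v hv
        simp only [hf]
        rw [if_pos (by omega : v ≤ w)]
        split_ifs with h1
        · have := choose_mul_choose_lt (m := m) (A := h + v) (B := h - v) (by omega) (by omega)
            (by omega)
          rwa [add_assoc, Nat.sub_sub] at this
        · exact Nat.mul_pos (Nat.choose_pos (by omega)) (Nat.choose_pos (by omega)))
      (by simp [hf])
    have hc' : ∀ v : ℤ, M.count v = if v.natAbs ≤ w then
        m.choose (h + v.natAbs) * m.choose (h - v.natAbs) else 0 := by
      intro v
      rw [hc]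
      simp only [hf]
      split_ifs <;> first | rfl | omega
    have hcard : Multiset.card M =
        ∑ i ∈ Finset.Icc (h - w) (h + w), m.choose i * m.choose (2 * h - i) := by
      rw [← Multiset.sum_count_eq_card (s := Finset.Icc (-(w : ℤ)) w)]
      · refine Finset.sum_nbij' (fun v => (h + v).toNat) (fun i => (i : ℤ) - h) ?_ ?_ ?_ ?_ ?_
        · intro v hv
          simp only [Finset.mem_Icc] at hv ⊢
          omega
        · intro v hv
          simp only [Finset.mem_Icc] at hv ⊢
          omega
        · intro v hv
          simp only [Finset.mem_Icc] at hv ⊢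
          omega
        · intro v hv
          simp only [Finset.mem_Icc] at hv ⊢
          omega
        · intro v hv
          simp only [Finset.mem_Icc] at hv ⊢
          rw [hc', if_pos (by omega)]
          rcases le_total 0 v with h0 | h0
          · rw [show h + v.natAbs = (h + v).toNat by omega,
              show h - v.natAbs = 2 * h - (h + v).toNat by omega]
          · rw [show h - v.natAbs = (h + v).toNat by omega,
              show h + v.natAbs = 2 * h - (h + v).toNat by omega, mul_comm]
      · intro v hv
        have := Multiset.count_pos.2 hv
        rw [hc'] at this
        split_ifs at this with h1
        · simp only [Finset.mem_Icc]
          omega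
        · omega
    obtain ⟨g, hg, hle⟩ := hM.exists_zero_sum (p := p) q (by
      rw [hcard]
      refine le_trans (le_of_eq ?_) hp
      ring)
    obtain ⟨x, hx, hxc⟩ := exists_zero_sum_functions g
      (r := 2 * (q + 1) + 1) (fun j => by rw [(hg j).1, (hg j).2]; exact ⟨by ring, rfl⟩) hle
    refine ⟨x, hx, fun j i => ?_, fun v => (hxc v).trans ?_⟩
    · by_contra hji
      have h1 := hxc (x j i)
      rw [hc', if_neg hji, Nat.le_zero, Finset.card_eq_zero, Finset.filter_eq_empty_iff] at h1
      exact h1 (Finset.mem_univ (j, i)) rfl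
    · rw [hc']
      split_ifs
      · exact le_rfl
      · exact Nat.zero_le _

/-- The intersection sizes of the classes of the partitions with the two halves of the ground
set. -/
theorem exists_class_types {m h u p q r : ℕ} (hhu : h ≤ u) (hu : u + 2 ≤ 2 * h) (hm : u ≤ m)
    (hr : Odd r) (hr1 : r = 1 → u = h) (hsum : q * (2 * h - 1) + r * h = m)
    (hA : p * q ≤ ∑ i ∈ Finset.Icc (u + 1) (2 * h - 1),
      m.choose i * m.choose (2 * h - 1 - i))
    (hB : p * r ≤ ∑ i ∈ Finset.Icc (2 * h - u) u, m.choose i * m.choose (2 * h - i)) :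
    ∃ a b : Fin p → (Fin q × Bool ⊕ Fin r) → ℕ, (∀ j, ∑ i, a j i = m) ∧ (∀ j, ∑ i, b j i = m) ∧
      (∀ x y, (Finset.univ.filter fun e : Fin p × (Fin q × Bool ⊕ Fin r) =>
        a e.1 e.2 = x ∧ b e.1 e.2 = y).card ≤ m.choose x * m.choose y) ∧
      (∀ j i, a j (Sum.inl i) + b j (Sum.inl i) = 2 * h - 1 ∧
        (u < a j (Sum.inl i) ∨ u < b j (Sum.inl i))) ∧
      (∀ j i, a j (Sum.inr i) + b j (Sum.inr i) = 2 * h ∧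
        a j (Sum.inr i) ≤ u ∧ b j (Sum.inr i) ≤ u) := by
  obtain ⟨w, rfl⟩ := Nat.exists_eq_add_of_le hhu
  obtain ⟨t, ht, htc⟩ := exists_choice_of_card_le (ι := Fin p × Fin q) _ _
    (by simpa using hA)
  obtain ⟨x, hx0, hxw, hxc⟩ := exists_balanced_choice (m := m) (h := h) (w := w) (p := p) (r := r)
    (by omega) hm hr (fun h1 => by have := hr1 h1; omega)
    (by rwa [show h - w = 2 * h - (h + w) by omega])
  simp only [Finset.mem_Icc] at ht
  refine ⟨fun j => Sum.elim (fun e => if e.2 then t (j, e.1) else 2 * h - 1 - t (j, e.1))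
      (fun i => (h + x j i).toNat),
    fun j => Sum.elim (fun e => if e.2 then 2 * h - 1 - t (j, e.1) else t (j, e.1))
      (fun i => (h - x j i).toNat), fun j => ?_, fun j => ?_, fun X Y => ?_, ?_, ?_⟩
  · rw [Fintype.sum_sum_type, Fintype.sum_prod_type]
    simp only [Sum.elim_inl, Sum.elim_inr, Fintype.sum_bool, if_true, Bool.false_eq_true, if_false]
    have h1 : ∀ i, t (j, i) + (2 * h - 1 - t (j, i)) = 2 * h - 1 := fun i => by
      have := ht (j, i); omega
    have h2 : ∑ i, (h + x j i).toNat = r * h := by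
      zify
      rw [Finset.sum_congr rfl (g := fun i => (h : ℤ) + x j i) fun i _ =>
        Int.toNat_of_nonneg (by have := hxw j i; omega), Finset.sum_add_distrib, hx0]
      simp
    simp only [h1, h2, Finset.sum_const, Finset.card_univ, Fintype.card_fin, smul_eq_mul, hsum]
  · rw [Fintype.sum_sum_type, Fintype.sum_prod_type]
    simp only [Sum.elim_inl, Sum.elim_inr, Fintype.sum_bool, if_true, Bool.false_eq_true, if_false]
    have h1 : ∀ i, (2 * h - 1 - t (j, i)) + t (j, i) = 2 * h - 1 := fun i => by
      have := ht (j, i); omega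
    have h2 : ∑ i, (h - x j i).toNat = r * h := by
      zify
      rw [Finset.sum_congr rfl (g := fun i => (h : ℤ) - x j i) fun i _ =>
        Int.toNat_of_nonneg (by have := hxw j i; omega), Finset.sum_sub_distrib, hx0]
      simp
    simp only [h1, h2, Finset.sum_const, Finset.card_univ, Fintype.card_fin, smul_eq_mul, hsum]
  · by_cases hXY : X + Y = 2 * h
    · have h1 : m.choose (h + ((X : ℤ) - h).natAbs) * m.choose (h - ((X : ℤ) - h).natAbs) =
          m.choose X * m.choose Y := by
        rcases le_total h X with h0 | h0
        · rw [show h + ((X : ℤ) - h).natAbs = X by omega,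
            show h - ((X : ℤ) - h).natAbs = Y by omega]
        · rw [show h + ((X : ℤ) - h).natAbs = Y by omega,
            show h - ((X : ℤ) - h).natAbs = X by omega, mul_comm]
      rw [← h1]
      refine le_trans ((Finset.card_le_card ?_).trans (Finset.card_image_le
        (f := fun e : Fin p × Fin r => (e.1, (Sum.inr e.2 : Fin q × Bool ⊕ Fin r))))) (hxc _)
      rintro ⟨j, ⟨e, β⟩ | i⟩ he
      · have := ht (j, e)
        cases β <;> simp at he <;> omega
      · have := hxw j i
        simp only [Finset.mem_filter, Finset.mem_univ, true_and, Sum.elim_inr] at he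
        refine Finset.mem_image.2 ⟨(j, i), ?_, rfl⟩
        simp only [Finset.mem_filter, Finset.mem_univ, true_and]
        omega
    by_cases hXY' : X + Y = 2 * h - 1
    · by_cases hX : h + w < X
      · obtain rfl : Y = 2 * h - 1 - X := by omega
        refine le_trans ((Finset.card_le_card ?_).trans (Finset.card_image_le
          (f := fun e : Fin p × Fin q =>
            (e.1, (Sum.inl (e.2, true) : Fin q × Bool ⊕ Fin r))))) (htc X)
        rintro ⟨j, ⟨e, β⟩ | i⟩ he
        · have := ht (j, e)
          cases β
          · simp at he
            omega
          · simp at he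
            refine Finset.mem_image.2 ⟨(j, e), ?_, rfl⟩
            simpa using he.1
        · have := hxw j i
          simp at he
          omega
      · rw [mul_comm (m.choose X)]
        obtain rfl : X = 2 * h - 1 - Y := by omega
        refine le_trans ((Finset.card_le_card ?_).trans (Finset.card_image_le
          (f := fun e : Fin p × Fin q =>
            (e.1, (Sum.inl (e.2, false) : Fin q × Bool ⊕ Fin r))))) (htc Y)
        rintro ⟨j, ⟨e, β⟩ | i⟩ he
        · have := ht (j, e)
          cases β
          · simp at he
            refine Finset.mem_image.2 ⟨(j, e), ?_, rfl⟩
            simpa using he.2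
          · simp at he
            omega
        · have := hxw j i
          simp at he
          omega
    · rw [Finset.filter_eq_empty_iff.2]
      · simp
      · rintro ⟨j, ⟨e, β⟩ | i⟩ -
        · have := ht (j, e)
          cases β <;> simp <;> omega
        · have := hxw j i
          simp
          omega
  · rintro j ⟨e, β⟩
    have := ht (j, e)
    cases β <;> simp <;> omega
  · intro j i
    have := hxw j i
    simp only [Sum.elim_inr]
    omega

/-! ### Assembling the partition system -/

theorem mainTheorem6 (n k c r u : ℕ) (hnk : 2 * k ≤ n) (hk : 3 ≤ k)
    (hdiv : n = c * k + r) (hr : r < k) (hn : Even n) (hck : Odd (c * k))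
    (hu : u ∈ Finset.Icc ((c + 1) / 2) (c - 1)) (hu1 : r = 1 → u = (c + 1) / 2) :
    ∃ P : Finset (Finpartition (Finset.univ : Finset (Fin n))),
      IsAlmostUniformSPS n k P ∧ P.card = min (altA n c u / (k - r)) (altB n c u / r) := by
  set p := min (altA n c u / (k - r)) (altB n c u / r) with hp
  have hro : Odd r := by
    rw [hdiv, Nat.even_add'] at hn
    exact hn.1 hck
  obtain ⟨hc, hko⟩ := Nat.odd_mul.1 hck
  have hkr : Even (k - r) := Nat.Odd.sub_odd hko hro
  obtain ⟨q, hq⟩ := hkr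
  obtain ⟨m, hm⟩ := hn
  obtain ⟨h', hh⟩ := hc
  obtain ⟨h, rfl⟩ : ∃ h, h = h' + 1 := ⟨_, rfl⟩
  have hr0 : 0 < r := hro.pos
  have hk' : k = 2 * q + r := by omega
  rw [Finset.mem_Icc] at hu
  have hn2 : n / 2 = m := by omega
  have hcm : c < m := by
    have : c * 3 ≤ c * k := Nat.mul_le_mul_left _ hk
    omega
  have hc1 : c = 2 * (h' + 1) - 1 := by omega
  have hA : p * q ≤ ∑ i ∈ Finset.Icc (u + 1) (2 * (h' + 1) - 1),
      m.choose i * m.choose (2 * (h' + 1) - 1 - i) := by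
    have h1 : p * (k - r) ≤ altA n c u :=
      (Nat.mul_le_mul_right _ (min_le_left _ _)).trans (Nat.div_mul_le_self _ _)
    rw [altA, hn2, hq, ← two_mul, mul_left_comm] at h1
    rw [← hc1]
    exact Nat.le_of_mul_le_mul_left h1 two_pos
  have hB : p * r ≤ ∑ i ∈ Finset.Icc (2 * (h' + 1) - u) u,
      m.choose i * m.choose (2 * (h' + 1) - i) := by
    have h1 : p * r ≤ altB n c u :=
      (Nat.mul_le_mul_right _ (min_le_right _ _)).trans (Nat.div_mul_le_self _ _)
    rwa [altB, hn2, show c + 1 = 2 * (h' + 1) by omega] at h1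
  obtain ⟨a, b, ha, hb, hab, hin, hout⟩ := exists_class_types (m := m) (h := h' + 1) (u := u)
    (p := p) (q := q) (r := r) (by omega) (by omega) (by omega) hro
    (fun h1 => by have := hu1 h1; omega)
    (by
      rw [← hc1]
      have : 2 * (q * c + r * (h' + 1)) = c * k + r := by rw [hk', hh]; ring
      omega) hA hB
  set S₁ : Finset (Fin n) := Finset.univ.filter fun i => (i : ℕ) < m with hS₁
  set S₂ : Finset (Fin n) := Finset.univ.filter fun i => ¬(i : ℕ) < m with hS₂
  have hc₁ : S₁.card = m := by
    rw [hS₁, Fin.card_filter_val_lt]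
    omega
  have hc₂ : S₂.card = m := by
    have := Finset.card_filter_add_card_filter_not (s := (Finset.univ : Finset (Fin n)))
      (fun i => (i : ℕ) < m)
    rw [← hS₁, ← hS₂, hc₁, Finset.card_univ, Fintype.card_fin] at this
    omega
  have hdis : Disjoint S₁ S₂ := Finset.disjoint_filter_filter_not _ _ _
  have huni : S₁ ∪ S₂ = Finset.univ := Finset.filter_union_filter_not_eq _ _
  obtain ⟨T, hTa, hTb, hTu, hTi⟩ := exists_bipartite_partition S₁ S₂ hdis huni a b
    (by rwa [hc₁]) (by rwa [hc₂]) (by rwa [hc₁, hc₂])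
  have hTc : ∀ j i, (T j i).card = a j i + b j i := by
    intro j i
    rw [← hTa, ← hTb, ← Finset.card_union_of_disjoint
      (hdis.mono Finset.inter_subset_right Finset.inter_subset_right), ← Finset.inter_union_distrib_left,
      huni, Finset.inter_univ]
  have hab0 : ∀ j i, (a j i + b j i = c ∧ (u < a j i ∨ u < b j i)) ∨
      (a j i + b j i = c + 1 ∧ a j i ≤ u ∧ b j i ≤ u) := by
    rintro j (i | i)
    · have := hin j i
      left
      omega
    · have := hout j i
      right
      omega
  let π : Fin p → Finpartition (Finset.univ : Finset (Fin n)) := fun j =>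
    Finpartition.ofExistsUnique (Finset.univ.image (T j)) (fun _ _ => Finset.subset_univ _)
      (fun v _ => by
        obtain ⟨i, hi, hiu⟩ := hTu j v
        refine ⟨T j i, ⟨Finset.mem_image_of_mem _ (Finset.mem_univ i), hi⟩, ?_⟩
        rintro t ⟨ht, hvt⟩
        obtain ⟨i', -, rfl⟩ := Finset.mem_image.1 ht
        rw [hiu i' hvt])
      (fun h0 => by
        obtain ⟨i, -, hi⟩ := Finset.mem_image.1 h0
        have h1 := hTc j i
        rw [hi, Finset.card_empty] at h1
        have := hab0 j i
        omega)
  have hπ : ∀ j, (π j).parts = Finset.univ.image (T j) := fun j => rfl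
  have hπi : Function.Injective π := by
    intro j j' hjj
    have h1 : T j (Sum.inr ⟨0, hr0⟩) ∈ (π j').parts := by
      rw [← hjj, hπ]
      exact Finset.mem_image_of_mem _ (Finset.mem_univ _)
    rw [hπ] at h1
    obtain ⟨i', -, hi⟩ := Finset.mem_image.1 h1
    exact (hTi _ _ _ _ hi).1.symm
  refine ⟨Finset.univ.image π, ⟨⟨by simp, ?_, ?_⟩, ?_⟩, ?_⟩
  · intro ρ hρ
    obtain ⟨j, -, rfl⟩ := Finset.mem_image.1 hρ
    rw [hπ, Finset.card_image_of_injective _ fun i i' hi => (hTi _ _ _ _ hi).2, Finset.card_univ]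
    simp
    omega
  · intro ρ hρ ρ' hρ' hne A hA B hB hAB
    obtain ⟨j, -, rfl⟩ := Finset.mem_image.1 hρ
    obtain ⟨j', -, rfl⟩ := Finset.mem_image.1 hρ'
    rw [hπ] at hA hB
    obtain ⟨i, -, rfl⟩ := Finset.mem_image.1 hA
    obtain ⟨i', -, rfl⟩ := Finset.mem_image.1 hB
    have h1 : a j i ≤ a j' i' := by
      rw [← hTa, ← hTa]
      exact Finset.card_le_card (Finset.inter_subset_inter_right hAB)
    have h2 : b j i ≤ b j' i' := by
      rw [← hTb, ← hTb]
      exact Finset.card_le_card (Finset.inter_subset_inter_right hAB)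
    have h3 := hab0 j i
    have h4 := hab0 j' i'
    -- Containment bounds both traces, so a c-class with a trace above u cannot lie in a
    -- (c+1)-class. The sizes therefore agree and the classes are equal.
    have h5 : T j i = T j' i' := Finset.eq_of_subset_of_card_le hAB (by rw [hTc, hTc]; omega)
    exact hne (congrArg π (hTi _ _ _ _ h5).1)
  · intro ρ hρ A hA
    obtain ⟨j, -, rfl⟩ := Finset.mem_image.1 hρ
    rw [hπ] at hA
    obtain ⟨i, -, rfl⟩ := Finset.mem_image.1 hA
    have h1 : n / k = c := by
      rw [hdiv, mul_comm, Nat.mul_add_div (by omega), Nat.div_eq_of_lt hr, add_zero]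
    have h2 : n ⌈/⌉ k = c + 1 := by
      rw [Nat.ceilDiv_eq_add_pred_div, hdiv, show c * k + r + k - 1 = k * (c + 1) + (r - 1) by
        rw [mul_add, mul_comm k c]; omega, Nat.mul_add_div (by omega),
        Nat.div_eq_of_lt (by omega), add_zero]
    rw [h1, h2, hTc]
    have := hab0 j i
    omega
  · rw [Finset.card_image_of_injective _ hπi, Finset.card_univ, Fintype.card_fin]
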